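/- Let $A$ be a commutative noetherian ring with unit, let $n,m\ge 0$ be integers and $f_1,\dots,f_n\in A$. For every subset $S\subseteq\{1,\dots,n\}$ and every $j\in S$ let $d_S^j$ be an $A$-linear endomorphism of $A^{\oplus m}$ with $\det d_S^j=f_j$, and assume that these maps form an $n$-cube, i.e. $d_{S\smallsetminus\{j\}}^i\,d_S^j=d_{S\smallsetminus\{i\}}^j\,d_S^i$ for all $S$ and all distinct $i,j\in S$. Let $\operatorname{Kos}(d)$ be the total complex of this cube, namely the chain complex with $$\operatorname{Kos}(d)_k=\bigoplus_{\#S=k}F_S,\qquad F_S=A^{\oplus m}\qquad(k\ge 0),$$ whose boundary map $\operatorname{Kos}(d)_{k}\to\operatorname{Kos}(d)_{k-1}$ restricted to $F_S$ is, for each $j\in S$, the map $(-1)^{\#\{t\in S\,:\,t>j\}}\,d_S^j:F_S\to F_{S\smallsetminus\{j\}}$, and zero into the other summands. If $f_1,\dots,f_n$ is a regular sequence, in the sense that multiplication by $f_i$ is injective on $A/(f_1,\dots,f_{i-1})$ for every $i=1,\dots,n$ (it is not required that $A/(f_1,\dots,f_n)\ne 0$), then $\operatorname{Kos}(d)$ is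 $0$-spherical: $H_k(\operatorname{Kos}(d))=0$ for all $k\neq 0$. -/

import Mathlib

universe u v

namespace GenKoszul

open CategoryTheory

/-- An `n`-cube of `A`-modules all of whose vertices are the free module `A ^ m`: a family of
endomorphisms `d_S^j`, for `S` a subset of the index set and `j ∈ S`, where
`d_S^j` is read as a map from the vertex at `S` to the vertex at `S \ {j}`, and where all the
squares commute. (By functoriality this is the same as a contravariant functor on the poset of
subsets that takes the value `A ^ m` at each vertex.) -/
structure EndCube (A : Type u) [CommRing A] (m n : ℕ) where
  /-- the boundary morphism `d_S^j` -/
  d : (S : Finset (Fin n)) → (j : Fin n) → j ∈ S → ((Fin m → A) →ₗ[A] (Fin m → A))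
  comm : ∀ (S : Finset (Fin n)) (i j : Fin n) (hi : i ∈ S) (hj : j ∈ S)
    (hij : i ∈ S.erase j) (hji : j ∈ S.erase i),
    d (S.erase j) i hij ∘ₗ d S j hj = d (S.erase i) j hji ∘ₗ d S i hi

/-- The index set of the degree `k` part: the subsets with exactly `k` elements. -/
abbrev Idx (n k : ℕ) : Type := {S : Finset (Fin n) // S.card = k}

/-- `S \ {j}` for a `(k + 1)`-element subset `S` and `j ∈ S`. -/
def Idx.erase {n k : ℕ} (S : Idx n (k + 1)) (j : Fin n) (hj : j ∈ S.1) : Idx n k :=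
  ⟨S.1.erase j, by rw [Finset.card_erase_of_mem hj, S.2]; rfl⟩

/-- The sign `(-1) ^ #{t ∈ S | j < t}`. -/
def sgn {n : ℕ} (S : Finset (Fin n)) (j : Fin n) : ℤ :=
  (-1) ^ (S.filter (fun t => j < t)).card

/-- The degree `k` part of the total complex: the direct sum of a copy of `A ^ m` for each
`k`-element subset `S`. -/
abbrev Term (A : Type u) (m n k : ℕ) : Type u := Idx n k → Fin m → A

namespace EndCube

variable {A : Type u} [CommRing A] {m n : ℕ}

/-- The boundary map of the total complex. On the component at `S` it is the sum over `j ∈ S`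
of `(-1) ^ #{t ∈ S | j < t}` times `d_S^j`, with values in the component at `S \ {j}`. -/
noncomputable def boundary (x : EndCube A m n) (k : ℕ) :
    Term A m n (k + 1) →ₗ[A] Term A m n k :=
  LinearMap.lsum A (fun _ : Idx n (k + 1) => Fin m → A) ℤ fun S =>
    ∑ j : {j // j ∈ S.1}, sgn S.1 j.1 •
      (LinearMap.single A (fun _ : Idx n k => Fin m → A) (S.erase j.1 j.2) ∘ₗ x.d S.1 j.1 j.2)

theorem boundary_single (x : EndCube A m n) (k : ℕ) (S : Idx n (k + 1)) (v : Fin m → A) :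
    x.boundary k (Pi.single S v) =
      ∑ j : {j // j ∈ S.1}, sgn S.1 j.1 •
        (Pi.single (S.erase j.1 j.2) (x.d S.1 j.1 j.2 v) : Term A m n k) := by
  unfold boundary
  rw [LinearMap.lsum_piSingle]
  simp [LinearMap.sum_apply]

theorem sgn_erase_swap {n : ℕ} (S : Finset (Fin n)) (i j : Fin n) (hj : j ∈ S)
    (h : i < j) :
    sgn S i * sgn (S.erase i) j + sgn S j * sgn (S.erase j) i = 0 := by
  unfold sgn
  have h1 : (S.erase i).filter (fun t => j < t) = S.filter (fun t => j < t) := by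
    ext t; simp only [Finset.mem_filter, Finset.mem_erase]
    constructor
    · rintro ⟨⟨_, a⟩, b⟩; exact ⟨a, b⟩
    · rintro ⟨a, b⟩; exact ⟨⟨(h.trans b).ne', a⟩, b⟩
  have h2 : (S.erase j).filter (fun t => i < t) = (S.filter (fun t => i < t)).erase j := by
    ext t; simp only [Finset.mem_filter, Finset.mem_erase]; tauto
  have h3 : j ∈ S.filter (fun t => i < t) := by simp [hj, h]
  have h4 := Finset.card_erase_add_one h3
  rw [h1, h2, ← h4]
  ring

theorem boundary_comp_boundary (x : EndCube A m n) (k : ℕ) :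
    x.boundary k ∘ₗ x.boundary (k + 1) = 0 := by
  refine LinearMap.pi_ext fun S v => ?_
  simp only [LinearMap.comp_apply, boundary_single, map_sum, map_zsmul, LinearMap.zero_apply,
    Finset.smul_sum, smul_smul]
  rw [Finset.sum_sigma']
  refine Finset.sum_involution
    (fun p _ => ⟨⟨p.2.1, Finset.mem_of_mem_erase p.2.2⟩,
      ⟨p.1.1, Finset.mem_erase.2 ⟨(Finset.ne_of_mem_erase p.2.2).symm, p.1.2⟩⟩⟩) ?_ ?_ ?_ ?_
  · rintro ⟨⟨j, hj⟩, ⟨i, hi⟩⟩ -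
    have hi' : i ∈ S.1 := Finset.mem_of_mem_erase hi
    have hne : i ≠ j := Finset.ne_of_mem_erase hi
    have hji : j ∈ S.1.erase i := Finset.mem_erase.2 ⟨hne.symm, hj⟩
    have hS : (S.erase i hi').erase j hji = (S.erase j hj).erase i hi :=
      Subtype.ext (Finset.erase_right_comm (a := i) (b := j) (s := S.1))
    have hc := LinearMap.congr_fun (x.comm S.1 i j hi' hj hi hji) v
    simp only [LinearMap.comp_apply] at hc
    have hs : sgn S.1 j * sgn (S.1.erase j) i + sgn S.1 i * sgn (S.1.erase i) j = 0 := by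
      rcases lt_or_gt_of_ne hne with h | h
      · rw [add_comm]; exact sgn_erase_swap S.1 i j hj h
      · exact sgn_erase_swap S.1 j i hi' h
    change (sgn S.1 j * sgn (S.1.erase j) i) •
        (Pi.single ((S.erase j hj).erase i hi) (x.d (S.1.erase j) i hi (x.d S.1 j hj v)) :
          Term A m n k) +
      (sgn S.1 i * sgn (S.1.erase i) j) •
        (Pi.single ((S.erase i hi').erase j hji) (x.d (S.1.erase i) j hji (x.d S.1 i hi' v)) :
          Term A m n k) = 0
    rw [hS, hc, ← add_smul, hs, zero_smul]
  · rintro ⟨⟨j, hj⟩, ⟨i, hi⟩⟩ - - h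
    exact Finset.ne_of_mem_erase hi (congrArg (fun p => p.1.1) h)
  · intro _ _; simp
  · intro _ _; rfl

/-- The generalized Koszul complex of the family `d`: the total complex of the cube. -/
noncomputable def kos (x : EndCube A m n) : ChainComplex (ModuleCat.{u} A) ℕ :=
  ChainComplex.of (fun k => ModuleCat.of A (Term A m n k))
    (fun k => ModuleCat.ofHom (x.boundary k))
    (fun k => by
      rw [← ModuleCat.ofHom_comp, boundary_comp_boundary]
      rfl)

theorem kos_d (x : EndCube A m n) (k : ℕ) :
    x.kos.d (k + 1) k = ModuleCat.ofHom (x.boundary k) :=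
  (ChainComplex.of_d (fun k => ModuleCat.of A (Term A m n k))
    (fun k => ModuleCat.ofHom (x.boundary k)) k :)

end EndCube

/-- A chain complex is `p`-spherical if its homology vanishes in every degree other than `p`. -/
def IsSpherical {C : Type v} [Category.{u} C] [Abelian C] (p : ℕ) (E : ChainComplex C ℕ) : Prop :=
  ∀ k : ℕ, k ≠ p → Limits.IsZero (E.homology k)

end GenKoszul

/-! Each `f i` acts on homology in two incompatible ways. Putting `f i` times the adjugates of the
direction-`i` edges backwards along those edges gives a homotopy from `f i ^ 2` to zero
(`boundary_adjHomotopy_add`). The extra factor is needed because adjugates commute with the other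
edges only up to `f i`-torsion, and later terms of a regular sequence may be zero divisors in `A`.
On the other hand, for `r` regular on the terms, the long exact sequence of multiplication by `r`
makes `r` injective on `H_k` once `H_{k+1}` of the complex mod `r` vanishes. The homotopies descend
to this quotient, so induction on the sequence (`exact_of_isWeaklyRegular_of_sq_nullHomotopic`)
gains one degree per element; `n` elements reach from degree `n` down to degree 1. -/

open RingTheory.Sequence in
/-- A flat module inherits the weakly regular sequences of the base ring. -/
theorem RingTheory.Sequence.IsWeaklyRegular.of_flat_module {R M : Type*} [CommRing R]
    [AddCommGroup M] [Module R M] [Module.Flat R M] {rs : List R} (h : IsWeaklyRegular R rs) :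
    IsWeaklyRegular M rs :=
  ((TensorProduct.rid R M).isWeaklyRegular_congr rs).1 (h.isWeaklyRegular_lTensor (M₂ := M))

/-- A bounded complex on which a weakly regular sequence acts through elements whose squares are
null-homotopic is exact in the top degrees, one further degree for each element. -/
theorem exact_of_isWeaklyRegular_of_sq_nullHomotopic {R : Type*} [CommRing R] (N : ℕ)
    (rs : List R) {M : ℕ → Type*} [∀ k, AddCommGroup (M k)] [∀ k, Module R (M k)]
    (d : ∀ k, M (k + 1) →ₗ[R] M k) (hdd : ∀ k, d k ∘ₗ d (k + 1) = 0)
    (hN : ∀ k, N < k → Subsingleton (M k))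
    (hreg : ∀ k, RingTheory.Sequence.IsWeaklyRegular (M k) rs)
    (hnull : ∀ r ∈ rs, ∃ h : ∀ k, M k →ₗ[R] M (k + 1),
      ∀ k x, d (k + 1) (h (k + 1) x) + h k (d k x) = r ^ 2 • x)
    (k : ℕ) (hk : N < k + 1 + rs.length) : Function.Exact (d (k + 1)) (d k) := by
  induction rs generalizing M k with
  | nil =>
    have := hN (k + 1) (by simpa using hk)
    exact fun x => ⟨fun _ => ⟨0, Subsingleton.elim _ _⟩,
      fun _ => by rw [Subsingleton.elim x 0, map_zero]⟩
  | cons r rs ih =>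
    have hreg' k := (RingTheory.Sequence.isWeaklyRegular_cons_iff (M k) r rs).1 (hreg k)
    -- The sequence is one shorter, so the induction hypothesis is used one degree higher, on the
    -- complex mod `r`.
    have hquot : Function.Exact (QuotSMulTop.map r (d (k + 2))) (QuotSMulTop.map r (d (k + 1))) := by
      refine ih (M := fun k => QuotSMulTop r (M k)) (fun k => QuotSMulTop.map r (d k)) ?_ ?_
        (fun k => (hreg' k).2) ?_ (k + 1) (by rw [List.length_cons] at hk; omega)
      · intro k
        rw [← QuotSMulTop.map_comp, hdd, map_zero]
      · intro k hk
        have := hN k hk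
        exact (Submodule.mkQ_surjective _).subsingleton
      · intro a ha
        obtain ⟨h, hh⟩ := hnull a (List.mem_cons_of_mem _ ha)
        refine ⟨fun k => QuotSMulTop.map r (h k), fun k => LinearMap.congr_fun
          (f := QuotSMulTop.map r (d (k + 1)) ∘ₗ QuotSMulTop.map r (h (k + 1)) +
            QuotSMulTop.map r (h k) ∘ₗ QuotSMulTop.map r (d k)) (g := a ^ 2 • LinearMap.id) ?_⟩
        have hh' : d (k + 1) ∘ₗ h (k + 1) + h k ∘ₗ d k = a ^ 2 • LinearMap.id :=
          LinearMap.ext (hh k)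
        rw [← QuotSMulTop.map_comp, ← QuotSMulTop.map_comp, ← map_add, hh', map_smul,
          QuotSMulTop.map_id]
    -- Injectivity of `r` on homology: if `r • x = d y`, then `y` is a cycle mod `r`, hence `y = d z
    -- + r • w`, and cancelling `r` gives `x = d w`.
    have hdiv (x : M (k + 1)) (hx : r • x ∈ Set.range (d (k + 1))) :
        x ∈ Set.range (d (k + 1)) := by
      obtain ⟨y, hy⟩ := hx
      obtain ⟨z, hz⟩ := (hquot (Submodule.Quotient.mk y)).1 <| by
        rw [QuotSMulTop.map_apply_mk, hy, Submodule.Quotient.mk_eq_zero]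
        exact Submodule.smul_mem_pointwise_smul x r ⊤ trivial
      obtain ⟨z, rfl⟩ := Submodule.mkQ_surjective _ z
      rw [Submodule.mkQ_apply, QuotSMulTop.map_apply_mk, eq_comm, Submodule.Quotient.eq] at hz
      obtain ⟨w, -, hw⟩ := (Submodule.mem_smul_pointwise_iff_exists _ _ _).1 hz
      refine ⟨w, (hreg' (k + 1)).1 ?_⟩
      change r • d (k + 1) w = r • x
      have hdz : d (k + 1) (d (k + 2) z) = 0 := LinearMap.congr_fun (hdd (k + 1)) z
      rw [← map_smul, hw, map_sub, hdz, sub_zero, hy]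
    refine fun x => ⟨fun hx => ?_, ?_⟩
    -- For a cycle `x` the homotopy makes `r ^ 2 • x` a boundary; divide by `r` twice.
    · obtain ⟨h, hh⟩ := hnull r List.mem_cons_self
      have := hh k x
      rw [hx, map_zero, add_zero, pow_two, mul_smul] at this
      exact hdiv x (hdiv _ ⟨_, this⟩)
    · rintro ⟨y, rfl⟩
      exact LinearMap.congr_fun (hdd k) y

namespace LinearMap

variable {R : Type*} [CommRing R] {ι : Type*} [Fintype ι] [DecidableEq ι]

/-- The endomorphism of a finite free module whose matrix is the adjugate. -/
noncomputable def piAdjugate (φ : (ι → R) →ₗ[R] (ι → R)) : (ι → R) →ₗ[R] (ι → R) :=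
  Matrix.toLin' (LinearMap.toMatrix' φ).adjugate

theorem comp_piAdjugate (φ : (ι → R) →ₗ[R] (ι → R)) :
    φ ∘ₗ φ.piAdjugate = LinearMap.det φ • LinearMap.id := by
  apply LinearMap.toMatrix'.injective
  rw [piAdjugate, LinearMap.toMatrix'_comp, LinearMap.toMatrix'_toLin', Matrix.mul_adjugate, map_smul,
    LinearMap.toMatrix'_id, LinearMap.det_toMatrix']

theorem piAdjugate_comp (φ : (ι → R) →ₗ[R] (ι → R)) :
    φ.piAdjugate ∘ₗ φ = LinearMap.det φ • LinearMap.id := by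
  apply LinearMap.toMatrix'.injective
  rw [piAdjugate, LinearMap.toMatrix'_comp, LinearMap.toMatrix'_toLin', Matrix.adjugate_mul, map_smul,
    LinearMap.toMatrix'_id, LinearMap.det_toMatrix']

/-- In a commutative square with two parallel sides of determinant `a`, the adjugates of these
sides commute with the other two sides up to `a`-torsion. -/
theorem smul_piAdjugate_comm {φ φ' ψ ψ' : (ι → R) →ₗ[R] (ι → R)} {a : R}
    (hφ : LinearMap.det φ = a) (hφ' : LinearMap.det φ' = a) (h : φ' ∘ₗ ψ = ψ' ∘ₗ φ) :
    a • (ψ ∘ₗ φ.piAdjugate) = a • (φ'.piAdjugate ∘ₗ ψ') := by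
  calc a • (ψ ∘ₗ φ.piAdjugate) = (φ'.piAdjugate ∘ₗ φ') ∘ₗ ψ ∘ₗ φ.piAdjugate := by
        rw [piAdjugate_comp, hφ', LinearMap.smul_comp, LinearMap.id_comp]
    _ = φ'.piAdjugate ∘ₗ (φ' ∘ₗ ψ) ∘ₗ φ.piAdjugate := rfl
    _ = φ'.piAdjugate ∘ₗ ψ' ∘ₗ (φ ∘ₗ φ.piAdjugate) := by rw [h]; rfl
    _ = a • (φ'.piAdjugate ∘ₗ ψ') := by
        rw [comp_piAdjugate, hφ, LinearMap.comp_smul, LinearMap.comp_smul, LinearMap.comp_id]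

end LinearMap

namespace GenKoszul

theorem sgn_mul_self {n : ℕ} (S : Finset (Fin n)) (j : Fin n) : sgn S j * sgn S j = 1 := by
  rw [sgn, ← mul_pow]
  simp

/-- Anticommutation of the signs when direction `i` is traversed backwards, obtained from
`sgn_erase_swap` since signs square to 1. -/
theorem sgn_mul_sgn_add {n : ℕ} {S : Finset (Fin n)} {i j : Fin n} (hi : i ∈ S) (hj : j ∈ S)
    (hij : i ≠ j) : sgn S i * sgn S j + sgn (S.erase i) j * sgn (S.erase j) i = 0 := by
  have h : sgn S i * sgn (S.erase i) j + sgn S j * sgn (S.erase j) i = 0 := by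
    rcases lt_or_gt_of_ne hij with h | h
    · exact EndCube.sgn_erase_swap S i j hj h
    · rw [add_comm]
      exact EndCube.sgn_erase_swap S j i hi h
  linear_combination (sgn S j * sgn (S.erase i) j) * h -
    sgn S i * sgn S j * sgn_mul_self (S.erase i) j -
    sgn (S.erase i) j * sgn (S.erase j) i * sgn_mul_self S j

/-- `S ∪ {i}` for a `k`-element subset `S` and `i ∉ S`. -/
def Idx.insert {n k : ℕ} (S : Idx n k) (i : Fin n) (hi : i ∉ S.1) : Idx n (k + 1) :=
  ⟨Insert.insert i S.1, by rw [Finset.card_insert_of_notMem hi, S.2]⟩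

namespace EndCube

variable {A : Type u} [CommRing A] {m n : ℕ}

/-- The degree one map of the total complex that, on the component at a subset `S` not
containing `i`, is `± det d • adj d` for `d` the edge from `S ∪ {i}` to `S`. -/
noncomputable def adjHomotopy (x : EndCube A m n) (a : A) (i : Fin n) (k : ℕ) :
    Term A m n k →ₗ[A] Term A m n (k + 1) :=
  LinearMap.lsum A (fun _ : Idx n k => Fin m → A) ℤ fun S =>
    if hi : i ∈ S.1 then 0 else
      sgn (S.insert i hi).1 i • (LinearMap.single A (fun _ : Idx n (k + 1) => Fin m → A)
        (S.insert i hi) ∘ₗ (a • (x.d (S.insert i hi).1 i (Finset.mem_insert_self _ _)).piAdjugate))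

theorem adjHomotopy_single_of_mem (x : EndCube A m n) (a : A) {i : Fin n} {k : ℕ} (S : Idx n k)
    (hi : i ∈ S.1) (v : Fin m → A) : x.adjHomotopy a i k (Pi.single S v) = 0 := by
  rw [adjHomotopy, LinearMap.lsum_piSingle, dif_pos hi, LinearMap.zero_apply]

theorem adjHomotopy_erase_single (x : EndCube A m n) (a : A) {i : Fin n} {k : ℕ}
    (S : Idx n (k + 1)) (hi : i ∈ S.1) (v : Fin m → A) :
    x.adjHomotopy a i k (Pi.single (S.erase i hi) v) =
      sgn S.1 i • (Pi.single S (a • (x.d S.1 i hi).piAdjugate v) : Term A m n (k + 1)) := by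
  have hn : i ∉ (S.erase i hi).1 := Finset.notMem_erase i S.1
  -- Reinserting `i` returns `S` only propositionally; a free `T` allows substitution in the
  -- dependent edge map.
  have key : ∀ T : Idx n (k + 1), T = S → ∀ hT : i ∈ T.1,
      sgn T.1 i • (LinearMap.single A (fun _ : Idx n (k + 1) => Fin m → A)
        T ∘ₗ (a • (x.d T.1 i hT).piAdjugate)) v =
      sgn S.1 i • (Pi.single S (a • (x.d S.1 i hi).piAdjugate v) : Term A m n (k + 1)) := by
    rintro T rfl hT
    rfl
  rw [adjHomotopy, LinearMap.lsum_piSingle, dif_neg hn]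
  exact key _ (Subtype.ext (Finset.insert_erase hi)) _

theorem boundary_adjHomotopy_add (x : EndCube A m n) {a : A} {i : Fin n}
    (hdet : ∀ (S : Finset (Fin n)) (hi : i ∈ S), LinearMap.det (x.d S i hi) = a) (k : ℕ) :
    x.boundary (k + 1) ∘ₗ x.adjHomotopy a i (k + 1) + x.adjHomotopy a i k ∘ₗ x.boundary k =
      a ^ 2 • LinearMap.id := by
  refine LinearMap.pi_ext fun T v => ?_
  simp only [LinearMap.add_apply, LinearMap.comp_apply, LinearMap.smul_apply, LinearMap.id_apply]
  by_cases hi : i ∈ T.1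
  · rw [adjHomotopy_single_of_mem x a T hi, map_zero, zero_add, boundary_single, map_sum,
      Finset.sum_eq_single ⟨i, hi⟩]
    · have hadj := LinearMap.congr_fun (x.d T.1 i hi).piAdjugate_comp v
      rw [hdet, LinearMap.comp_apply] at hadj
      rw [map_zsmul, adjHomotopy_erase_single, smul_smul, sgn_mul_self, one_smul, hadj,
        LinearMap.smul_apply, LinearMap.id_apply, smul_smul, ← pow_two, Pi.single_smul]
    -- Faces in a direction other than `i` still contain `i`, where the homotopy is zero.
    · rintro ⟨j, hj⟩ - hne
      have hij : i ≠ j := fun h => hne (Subtype.ext h.symm)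
      rw [map_zsmul, adjHomotopy_single_of_mem x a _ (Finset.mem_erase.2 ⟨hij, hi⟩), smul_zero]
    · exact fun h => absurd (Finset.mem_univ _) h
  · obtain ⟨S, hS, rfl⟩ : ∃ (S : Idx n (k + 2)) (hS : i ∈ S.1), T = S.erase i hS :=
      ⟨T.insert i hi, Finset.mem_insert_self _ _, Subtype.ext (Finset.erase_insert hi).symm⟩
    rw [adjHomotopy_erase_single, map_zsmul, boundary_single, boundary_single,
      ← Finset.add_sum_erase _ _ (Finset.mem_univ ⟨i, hS⟩), smul_add, add_assoc]
    have hdiag : sgn S.1 i • sgn S.1 i • (Pi.single (S.erase i hS)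
        (x.d S.1 i hS (a • (x.d S.1 i hS).piAdjugate v)) : Term A m n (k + 1)) =
        a ^ 2 • Pi.single (S.erase i hS) v := by
      have hadj := LinearMap.congr_fun (x.d S.1 i hS).comp_piAdjugate v
      rw [hdet, LinearMap.comp_apply] at hadj
      rw [smul_smul, sgn_mul_self, one_smul, map_smul, hadj,
        LinearMap.smul_apply, LinearMap.id_apply, smul_smul, ← pow_two, Pi.single_smul]
    -- The diagonal term already gives `a ^ 2`; the remaining terms cancel in pairs, one pair for
    -- each `j ≠ i` in `S`.
    rw [hdiag, add_eq_left, Finset.smul_sum, map_sum, add_eq_zero_iff_eq_neg, ← Finset.sum_neg_distrib]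
    refine Finset.sum_bij
      (fun j hj => ⟨j.1, Finset.mem_erase.2
        ⟨fun h => (Finset.ne_of_mem_erase hj) (Subtype.ext h), j.2⟩⟩) ?_ ?_ ?_ ?_
    · exact fun _ _ => Finset.mem_univ _
    · exact fun _ _ _ _ h => Subtype.ext (Subtype.mk.inj h)
    · rintro ⟨j, hj⟩ -
      exact ⟨⟨j, Finset.mem_of_mem_erase hj⟩, Finset.mem_erase.2
        ⟨fun h => Finset.ne_of_mem_erase hj (congrArg Subtype.val h), Finset.mem_univ _⟩, rfl⟩
    · rintro ⟨j, hj⟩ hmem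
      have hne : j ≠ i := fun h => Finset.ne_of_mem_erase hmem (Subtype.ext h)
      have hi' : i ∈ S.1.erase j := Finset.mem_erase.2 ⟨hne.symm, hS⟩
      have hj' : j ∈ S.1.erase i := Finset.mem_erase.2 ⟨hne, hj⟩
      have hcomm := LinearMap.congr_fun (LinearMap.smul_piAdjugate_comm (hdet S.1 hS)
        (hdet (S.1.erase j) hi') (x.comm S.1 i j hS hj hi' hj')) v
      simp only [LinearMap.smul_apply, LinearMap.comp_apply] at hcomm
      have herase : (S.erase i hS).erase j hj' = (S.erase j hj).erase i hi' :=
        Subtype.ext (Finset.erase_right_comm (a := i) (b := j) (s := S.1))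
      have hadj : x.adjHomotopy a i k (Pi.single ((S.erase j hj).erase i hi')
          (x.d (S.1.erase i) j hj' v)) = sgn (S.1.erase j) i • (Pi.single (S.erase j hj)
            (a • (x.d (S.1.erase j) i hi').piAdjugate (x.d (S.1.erase i) j hj' v)) :
              Term A m n (k + 1)) :=
        adjHomotopy_erase_single x a (S.erase j hj) hi' _
      change sgn S.1 i • sgn S.1 j • (Pi.single (S.erase j hj)
          (x.d S.1 j hj (a • (x.d S.1 i hS).piAdjugate v)) : Term A m n (k + 1)) =
        -(x.adjHomotopy a i k (sgn (S.1.erase i) j •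
          (Pi.single ((S.erase i hS).erase j hj') (x.d (S.1.erase i) j hj' v) : Term A m n k)))
      rw [herase, map_zsmul, hadj, map_smul, hcomm, smul_smul, smul_smul,
        ← add_eq_zero_iff_eq_neg]
      rw [← add_smul, sgn_mul_sgn_add hS hj hne.symm, zero_smul]

end EndCube

theorem Idx.isEmpty {n k : ℕ} (h : n < k) : IsEmpty (Idx n k) :=
  ⟨fun S => by simpa [S.2] using (Finset.card_le_univ S.1).trans_lt ((Fintype.card_fin n).trans_lt h)⟩

end GenKoszul

theorem theorem6p1 {A : Type u} [CommRing A] [IsNoetherianRing A] (n m : ℕ) (f : Fin n → A)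
    (d : GenKoszul.EndCube A m n)
    (hdet : ∀ (S : Finset (Fin n)) (j : Fin n) (hj : j ∈ S), LinearMap.det (d.d S j hj) = f j)
    (hf : RingTheory.Sequence.IsWeaklyRegular A (List.ofFn f)) :
    GenKoszul.IsSpherical 0 d.kos := by
  intro k hk
  obtain ⟨k, rfl⟩ := Nat.exists_eq_succ_of_ne_zero hk
  have hexact : Function.Exact (d.boundary (k + 1)) (d.boundary k) := by
    refine exact_of_isWeaklyRegular_of_sq_nullHomotopic n (List.ofFn f)
      (M := GenKoszul.Term A m n) d.boundary d.boundary_comp_boundary ?_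
      (fun k => hf.of_flat_module) ?_ k (by rw [List.length_ofFn]; omega)
    · intro k hk
      have := GenKoszul.Idx.isEmpty hk
      infer_instance
    · intro a ha
      obtain ⟨i, rfl⟩ := (List.mem_ofFn' f a).1 ha
      exact ⟨d.adjHomotopy (f i) i, fun k => LinearMap.congr_fun
        (d.boundary_adjHomotopy_add (fun S hi => hdet S i hi) k)⟩
  rw [← HomologicalComplex.exactAt_iff_isZero_homology,
    HomologicalComplex.exactAt_iff' _ (k + 2) (k + 1) k (by simp) (by simp),
    CategoryTheory.ShortComplex.moduleCat_exact_iff]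
  intro y hy
  change d.kos.d (k + 1) k y = 0 at hy
  change ∃ z, d.kos.d (k + 2) (k + 1) z = y
  rw [GenKoszul.EndCube.kos_d] at hy ⊢
  exact (hexact y).1 hy
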